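/- Let $N=\{1,\dots,n\}$ be a set of agents and let $k\in\{1,\dots,n-1\}$. Consider directed graphs $G=(N,E)$ without self-loops, let $\mathcal S_k$ be the set of $k$-subsets of $N$, and let $\deg(i)$ be the indegree of agent $i$ in $G$. A randomized $k$-selection mechanism $f$ maps each such graph $G$ to a probability distribution $f(G)$ on $\mathcal S_k$. It is *strategyproof* if for every agent $i$ and all graphs $G,G'$ that differ only in the outgoing edges of $i$, $\Pr_{S\sim f(G)}[i\in S]=\Pr_{S\sim f(G')}[i\in S]$. It has *approximation ratio* $\alpha$ if for every graph $G$ $$\max_{S\in\mathcal S_k}\sum_{i\in S}\deg(i)\;\le\;\alpha\cdot\mathbb E_{S\sim f(G)}\Big[\sum_{i\in S}\deg(i)\Big].$$ For an integer $m\ge 1$, the *Random $m$-Partition mechanism* ($m$-RP) works as follows. 1. Assign each agent independently and uniformly at random to one of $m$ subsets $S_1,\dots,S_m$. 2. Independently, let $T\subseteq\{1,\dots,m\}$ be a uniformly random subset of size $k-m\lfloor k/m\rfloor$. 3. For each $t$, select from $S_t$ the $\lceil k/m\rceil$ agents (if $t\in T$), respectively the $\lfloor k/m\rfloor$ agents (if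 $t\notin T$), with the highest indegrees counting only edges from $N\setminus S_t$, ties being broken in favour of the smaller index; if $S_t$ has fewer agents than that, select all of $S_t$. 4. If only $k'<k$ agents were selected in step 3, select $k-k'$ additional agents uniformly at random from the agents not yet selected. Then $m$-RP is strategyproof for every $m\ge 1$. Furthermore: 1. $2$-RP has approximation ratio $4$. 2. $\lceil k^{1/3}\rceil$-RP has approximation ratio $1+O(k^{-1/3})$; that is, there is an absolute constant $C$ such that for all $k\ge 2$ and all $n>k$, $\lceil k^{1/3}\rceil$-RP has approximation ratio $1+C/k^{1/3}$. -/

import Mathlib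

namespace Selection

open Finset

/-- A directed graph on the agents `Fin n`, without self-loops; `G.Adj i j` means that agent `i`
supports agent `j`. -/
structure AgentGraph (n : ℕ) extends Digraph (Fin n) where
  loopless : ∀ i, ¬ Adj i i

open Classical in
/-- The number of edges into `i`. -/
noncomputable def indeg {n : ℕ} (G : AgentGraph n) (i : Fin n) : ℕ :=
  #{j | G.Adj j i}

/-- The collection of `k`-subsets of the set of agents. -/
abbrev KSubset (n k : ℕ) : Type := {S : Finset (Fin n) // S.card = k}

/-- A randomized `k`-selection mechanism. -/
abbrev Mechanism (n k : ℕ) : Type := AgentGraph n → PMF (KSubset n k)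

/-- Expectation of `g S` for `S` drawn from `μ` (a finite sum). -/
noncomputable def expect {n k : ℕ} (μ : PMF (KSubset n k)) (g : KSubset n k → ℝ) : ℝ :=
  ∑ S, (μ S).toReal * g S

/-- The utility of agent `i`: the probability of being selected, i.e. the expectation of the
0-1 utility. -/
noncomputable def utility {n k : ℕ} (μ : PMF (KSubset n k)) (i : Fin n) : ℝ :=
  expect μ (fun S => if i ∈ S.1 then 1 else 0)

/-- The two graphs have the same edges, except possibly those going out of `i`. -/
def DifferOnlyAt {n : ℕ} (i : Fin n) (G G' : AgentGraph n) : Prop :=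
  ∀ j, j ≠ i → ∀ l, G.Adj j l ↔ G'.Adj j l

/-- The probability of being selected does not depend on the agent's own outgoing edges. -/
def IsStrategyproof {n k : ℕ} (f : Mechanism n k) : Prop :=
  ∀ (i : Fin n) (G G' : AgentGraph n), DifferOnlyAt i G G' → utility (f G) i = utility (f G') i

/-- The maximum over all `k`-subsets of the sum of indegrees. -/
noncomputable def opt {n : ℕ} (k : ℕ) (G : AgentGraph n) : ℕ :=
  (powersetCard k (univ : Finset (Fin n))).sup (fun S => ∑ i ∈ S, indeg G i)

/-- `f` has an approximation ratio of `α`: the optimum is at most `α` times the expected sum of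
indegrees of the selected agents. (Written as a product, so that an optimum of zero is harmless,
while a zero expectation with a positive optimum is an infinite ratio.) -/
def HasApproxRatio {n k : ℕ} (f : Mechanism n k) (α : ℝ) : Prop :=
  ∀ G : AgentGraph n,
    (opt k G : ℝ) ≤ α * expect (f G) (fun S => ∑ i ∈ S.1, (indeg G i : ℝ))

section Mechanism

variable {n m : ℕ}

open Classical in
/-- The indegree of `i` based only on the edges from agents in other parts. The partition is
given by `p`, which sends an agent to the index of its part. -/
noncomputable def crossIndeg (G : AgentGraph n) (p : Fin n → Fin m) (i : Fin n) : ℕ :=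
  #{j | G.Adj j i ∧ p j ≠ p i}

/-- The agent `j` is ranked before the agent `i`: larger cross indegree, ties broken in favour of
the agent with the smaller index. -/
def Before (G : AgentGraph n) (p : Fin n → Fin m) (j i : Fin n) : Prop :=
  crossIndeg G p i < crossIndeg G p j ∨ (crossIndeg G p i = crossIndeg G p j ∧ j < i)

open Classical in
/-- The number of agents of the same part that are ranked before `i`. -/
noncomputable def rank (G : AgentGraph n) (p : Fin n → Fin m) (i : Fin n) : ℕ :=
  #{j | p j = p i ∧ Before G p j i}

/-- The number of agents to be selected from the part `t`. -/
def quota (k : ℕ) (T : Finset (Fin m)) (t : Fin m) : ℕ :=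
  if t ∈ T then k ⌈/⌉ m else k / m

/-- The agents selected from the parts: from each part those that are ranked highest, as many as
the quota of the part (the whole part if it is smaller than its quota). -/
noncomputable def topAgents (k : ℕ) (G : AgentGraph n) (p : Fin n → Fin m) (T : Finset (Fin m)) :
    Finset (Fin n) :=
  {i | rank G p i < quota k T (p i)}

theorem rank_lt_of_before (G : AgentGraph n) (p : Fin n → Fin m) {i j : Fin n}
    (hp : p j = p i) (h : Before G p j i) : rank G p j < rank G p i := by
  classical
  unfold rank
  apply Finset.card_lt_card
  rw [Finset.ssubset_iff_of_subset]
  · refine ⟨j, by simp [hp, h], ?_⟩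
    intro hmem
    have h2 := (Finset.mem_filter.mp hmem).2.2
    unfold Before at h2
    omega
  · intro l hl
    simp only [Finset.mem_filter, Finset.mem_univ, true_and] at hl ⊢
    refine ⟨hl.1.trans hp, ?_⟩
    have h2 := hl.2
    unfold Before at *
    omega

theorem rank_injOn (G : AgentGraph n) (p : Fin n → Fin m) {i j : Fin n}
    (hp : p j = p i) (h : rank G p j = rank G p i) : j = i := by
  by_contra hne
  have : Before G p j i ∨ Before G p i j := by
    unfold Before
    omega
  rcases this with h1 | h1
  · exact absurd h (rank_lt_of_before G p hp h1).ne
  · exact absurd h (rank_lt_of_before G p hp.symm h1).ne'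

theorem sum_quota_le (k : ℕ) (hm : 0 < m) {T : Finset (Fin m)}
    (hT : T.card = k - m * (k / m)) : ∑ t, quota k T t ≤ k := by
  have hq : ∀ t, quota k T t ≤ k / m + if t ∈ T then 1 else 0 := by
    intro t
    unfold quota
    split_ifs
    · rw [Nat.ceilDiv_eq_add_pred_div]
      calc (k + m - 1) / m ≤ (k + m) / m := Nat.div_le_div_right (by omega)
        _ = k / m + 1 := Nat.add_div_right k hm
    · simp
  calc ∑ t, quota k T t ≤ ∑ t, (k / m + if t ∈ T then 1 else 0) := Finset.sum_le_sum fun t _ => hq t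
    _ = m * (k / m) + T.card := by
      rw [Finset.sum_add_distrib]
      simp
    _ = k := by
      have := Nat.mul_div_le k m
      omega

theorem card_topAgents_le (k : ℕ) (G : AgentGraph n) (p : Fin n → Fin m) (hm : 0 < m)
    {T : Finset (Fin m)} (hT : T.card = k - m * (k / m)) : (topAgents k G p T).card ≤ k := by
  classical
  refine le_trans ?_ (sum_quota_le k hm hT)
  rw [Finset.card_eq_sum_card_fiberwise (f := p) (t := Finset.univ) (by intro x _; simp)]
  refine Finset.sum_le_sum fun t _ => ?_
  rw [← Finset.card_range (quota k T t)]
  refine Finset.card_le_card_of_injOn (rank G p) ?_ ?_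
  · intro i hi
    simp only [topAgents, Finset.coe_filter, Finset.mem_filter, Finset.mem_univ, true_and,
      Set.mem_ofPred_eq] at hi
    simpa [← hi.2] using hi.1
  · intro i hi j hj hij
    simp only [Finset.coe_filter, Set.mem_ofPred_eq] at hi hj
    exact rank_injOn G p (hi.2.trans hj.2.symm) hij

/-- Subsets of `A`'s complement of the size that is needed to complete `A` to a `k`-subset. -/
abbrev Filler (k : ℕ) (A : Finset (Fin n)) : Type :=
  {B : Finset (Fin n) // B ∈ powersetCard (k - A.card) Aᶜ}

theorem filler_nonempty {k : ℕ} (hkn : k ≤ n) (A : Finset (Fin n)) : Nonempty (Filler k A) := by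
  have h : (powersetCard (k - A.card) Aᶜ).Nonempty := by
    apply Finset.powersetCard_nonempty_of_le
    rw [Finset.card_compl, Fintype.card_fin]
    omega
  exact ⟨⟨h.choose, h.choose_spec⟩⟩

theorem card_union_filler {k : ℕ} {A : Finset (Fin n)} (hA : A.card ≤ k) (B : Filler k A) :
    (A ∪ B.1).card = k := by
  obtain ⟨B, hB⟩ := B
  rw [Finset.mem_powersetCard] at hB
  have hd : Disjoint A B := Finset.disjoint_left.mpr fun x hx hxB =>
    (Finset.mem_compl.mp (hB.1 hxB)) hx
  rw [Finset.card_union_of_disjoint hd, hB.2]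
  omega

/-- Complete `A` to a `k`-subset by agents chosen uniformly at random outside `A`. -/
noncomputable def fill {k : ℕ} (hkn : k ≤ n) (A : Finset (Fin n)) (hA : A.card ≤ k) :
    PMF (KSubset n k) :=
  haveI := filler_nonempty hkn A
  (PMF.uniformOfFintype (Filler k A)).map fun B => ⟨A ∪ B.1, card_union_filler hA B⟩

/-- Subsets of the set of parts that have `k - m * ⌊k / m⌋` elements. -/
abbrev PartSubset (k m : ℕ) : Type := {T : Finset (Fin m) // T.card = k - m * (k / m)}

theorem partSubset_nonempty (k : ℕ) (hm : 0 < m) : Nonempty (PartSubset k m) := by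
  have hle : k - m * (k / m) ≤ (Finset.univ : Finset (Fin m)).card := by
    rw [Finset.card_univ, Fintype.card_fin, ← Nat.mod_eq_sub_mul_div]
    exact (Nat.mod_lt k hm).le
  obtain ⟨T, -, hT⟩ := Finset.exists_subset_card_eq hle
  exact ⟨⟨T, hT⟩⟩

end Mechanism

/-- The Random `m`-Partition mechanism: a uniformly random assignment `p` of the agents to the
`m` parts (equivalently, each agent is assigned independently and uniformly), a uniformly random
set `T` of parts that get the larger quota, selection of the top agents of each part, and
completion at random. -/
noncomputable def randomPartition (n k m : ℕ) (hkn : k ≤ n) (hm : 0 < m) : Mechanism n k :=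
  fun G =>
    haveI : Nonempty (Fin m) := ⟨⟨0, hm⟩⟩
    haveI := partSubset_nonempty k hm
    (PMF.uniformOfFintype (Fin n → Fin m)).bind fun p =>
      (PMF.uniformOfFintype (PartSubset k m)).bind fun T =>
        fill hkn (topAgents k G p T.1) (card_topAgents_le k G p hm T.2)

/-- `⌈k^{1/3}⌉`. -/
noncomputable def ceilCbrt (k : ℕ) : ℕ := ⌈(k : ℝ) ^ (1 / 3 : ℝ)⌉₊

theorem ceilCbrt_pos {k : ℕ} (hk : 0 < k) : 0 < ceilCbrt k :=
  Nat.ceil_pos.mpr (Real.rpow_pos_of_pos (by exact_mod_cast hk) _)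

end Selection

/-! Strategyproofness: fix the partition and `T`. Edges inside a part are not counted, so an agent
cannot affect its own rank. It could still affect who is selected from other parts, but the number
of agents selected before the completion is `∑ t, min (quota t) |S_t|`, whatever the graph
(`card_topAgents`), and the chance of being added at random depends only on that number
(`utility_fill_of_notMem`).

Ratio: fix an optimal `K`. The top agents of `S_t` collect at least a fraction `w t ≤ 1` of the
cross indegree of `K ∩ S_t` whenever `w t * |K ∩ S_t| ≤ quota t` (`mul_sum_le_sum_top`). By
linearity it suffices to bound, for each edge `u → v` into `K`, the mean of `w (p v)` over the event
`p u ≠ p v` (`mul_sum_indeg_le_expect`). Two weights are used. The choice `quota / k` gives `(1 -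
1/m) / m`, which is `1/4` for `m = 2`. The choice `quota / max quota |K ∩ S_t|` loses `1/m` for
internal edges and, by a second moment bound, about `√(k/m) / (k/m)` for overfull parts; at `m ≈
k^{1/3}` both losses are of order `k^{-1/3}`. -/

namespace Selection

open Finset

/-! ### Expectations under the mechanism and the random completion. -/

section Expect

variable {n k : ℕ}

theorem expect_pure (S : KSubset n k) (g : KSubset n k → ℝ) : expect (PMF.pure S) g = g S := by
  classical
  unfold expect
  rw [Finset.sum_eq_single S]
  · simp
  · intro S' _ h
    simp [PMF.pure_apply, h]
  · simp

theorem expect_bind_uniform {α : Type*} [Fintype α] [Nonempty α] (f : α → PMF (KSubset n k))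
    (g : KSubset n k → ℝ) :
    expect ((PMF.uniformOfFintype α).bind f) g
      = (Fintype.card α : ℝ)⁻¹ * ∑ a, expect (f a) g := by
  unfold expect
  rw [Finset.sum_comm, Finset.mul_sum]
  refine Finset.sum_congr rfl fun S _ => ?_
  rw [PMF.bind_apply, tsum_fintype, ENNReal.toReal_sum, Finset.sum_mul, Finset.mul_sum]
  · refine Finset.sum_congr rfl fun a _ => ?_
    simp [mul_assoc]
  · intro a _
    exact ENNReal.mul_ne_top (PMF.apply_ne_top _ _) (PMF.apply_ne_top _ _)

theorem expect_map_uniform {α : Type*} [Fintype α] [Nonempty α] (f : α → KSubset n k)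
    (g : KSubset n k → ℝ) :
    expect ((PMF.uniformOfFintype α).map f) g = (Fintype.card α : ℝ)⁻¹ * ∑ a, g (f a) := by
  rw [PMF.map, expect_bind_uniform]
  simp [expect_pure]

theorem expect_randomPartition (m : ℕ) (hkn : k ≤ n) (hm : 0 < m) (G : AgentGraph n)
    (g : KSubset n k → ℝ) :
    expect (randomPartition n k m hkn hm G) g
      = (Fintype.card (Fin n → Fin m) : ℝ)⁻¹ * ∑ p : Fin n → Fin m,
        (Fintype.card (PartSubset k m) : ℝ)⁻¹ * ∑ T : PartSubset k m,
          expect (fill hkn (topAgents k G p T.1) (card_topAgents_le k G p hm T.2)) g := by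
  have : Nonempty (Fin m) := ⟨⟨0, hm⟩⟩
  have := partSubset_nonempty k hm
  unfold randomPartition
  rw [expect_bind_uniform]
  simp only [expect_bind_uniform]

theorem utility_randomPartition (m : ℕ) (hkn : k ≤ n) (hm : 0 < m) (G : AgentGraph n)
    (i : Fin n) :
    utility (randomPartition n k m hkn hm G) i
      = (Fintype.card (Fin n → Fin m) : ℝ)⁻¹ * ∑ p : Fin n → Fin m,
        (Fintype.card (PartSubset k m) : ℝ)⁻¹ * ∑ T : PartSubset k m,
          utility (fill hkn (topAgents k G p T.1) (card_topAgents_le k G p hm T.2)) i :=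
  expect_randomPartition m hkn hm G _

/-- Filling up `A` can only increase a sum of nonnegative weights. -/
theorem sum_le_expect_fill (hkn : k ≤ n) (A : Finset (Fin n)) (hA : A.card ≤ k)
    (d : Fin n → ℝ) (hd : ∀ i, 0 ≤ d i) :
    ∑ i ∈ A, d i ≤ expect (fill hkn A hA) (fun S => ∑ i ∈ S.1, d i) := by
  have := filler_nonempty hkn A
  unfold fill
  rw [expect_map_uniform]
  have hc : (0 : ℝ) < Fintype.card (Filler k A) := by exact_mod_cast Fintype.card_pos
  rw [inv_mul_eq_div, le_div_iff₀ hc]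
  calc (∑ i ∈ A, d i) * (Fintype.card (Filler k A) : ℝ) = ∑ _B : Filler k A, ∑ i ∈ A, d i := by
        simp [mul_comm]
    _ ≤ _ := Finset.sum_le_sum fun B _ =>
        Finset.sum_le_sum_of_subset_of_nonneg Finset.subset_union_left fun i _ _ => hd i

theorem utility_fill_of_mem (hkn : k ≤ n) {A : Finset (Fin n)} (hA : A.card ≤ k) {i : Fin n}
    (hi : i ∈ A) : utility (fill hkn A hA) i = 1 := by
  have := filler_nonempty hkn A
  unfold utility fill
  rw [expect_map_uniform]
  have hc : (Fintype.card (Filler k A) : ℝ) ≠ 0 := by exact_mod_cast Fintype.card_ne_zero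
  rw [Finset.sum_congr rfl (g := fun _ => (1 : ℝ)) fun B _ => if_pos (mem_union_left _ hi),
    Finset.sum_const, card_univ, nsmul_eq_mul, mul_one, inv_mul_cancel₀ hc]

/-- Complementary counting: the fillers that avoid `i` are the subsets of `Aᶜ.erase i` of the same
size. What matters later is that `A` enters only through its cardinality. -/
theorem utility_fill_of_notMem (hkn : k ≤ n) {A : Finset (Fin n)} (hA : A.card ≤ k) {i : Fin n}
    (hi : i ∉ A) : utility (fill hkn A hA) i =
      ((n - A.card).choose (k - A.card) : ℝ)⁻¹ *
        ((n - A.card).choose (k - A.card) - (n - A.card - 1).choose (k - A.card)) := by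
  have := filler_nonempty hkn A
  have hcard : Fintype.card (Filler k A) = (n - A.card).choose (k - A.card) := by
    rw [Fintype.card_coe, card_powersetCard, card_compl, Fintype.card_fin]
  have hnot : ∑ B : Filler k A, (if i ∉ B.1 then (1 : ℝ) else 0)
      = (n - A.card - 1).choose (k - A.card) := by
    rw [Finset.sum_coe_sort (powersetCard (k - A.card) Aᶜ)
      (fun B => if i ∉ B then (1 : ℝ) else 0), Finset.sum_boole]
    have : {B ∈ powersetCard (k - A.card) Aᶜ | i ∉ B}
        = powersetCard (k - A.card) (Aᶜ.erase i) := by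
      ext B
      simp only [mem_filter, mem_powersetCard, Finset.subset_erase]
      tauto
    rw [this, card_powersetCard, card_erase_of_mem (by simpa using hi), card_compl,
      Fintype.card_fin]
  unfold utility fill
  rw [expect_map_uniform, hcard]
  congr 1
  rw [← hnot, ← hcard, eq_sub_iff_add_eq, ← Finset.sum_add_distrib]
  rw [Finset.sum_congr rfl (g := fun _ => (1 : ℝ))]
  · simp
  · intro B _
    by_cases h : i ∈ B.1 <;> simp [h, hi]

end Expect

/-! ### Ranking inside the parts, and strategyproofness. -/

section Parts

variable {n m : ℕ}

theorem rank_lt_card (G : AgentGraph n) (p : Fin n → Fin m) (i : Fin n) :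
    rank G p i < #{j | p j = p i} := by
  classical
  unfold rank
  apply Finset.card_lt_card
  rw [Finset.ssubset_iff_of_subset]
  · refine ⟨i, by simp, fun h => ?_⟩
    have h2 := (mem_filter.1 h).2.2
    unfold Before at h2
    omega
  · intro j hj
    simp only [Finset.mem_filter, Finset.mem_univ, true_and] at hj ⊢
    exact hj.1

/-- Ranks are distinct within a part and smaller than its size, so `rank` maps the part bijectively
onto an initial segment of `ℕ`. -/
theorem card_rank_lt (G : AgentGraph n) (p : Fin n → Fin m) (t : Fin m) (q : ℕ) :
    #{i | p i = t ∧ rank G p i < q} = min q #{i | p i = t} := by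
  have hinj : Set.InjOn (rank G p) ({i | p i = t} : Finset (Fin n)) := by
    intro i hi j hj hij
    simp only [Finset.coe_filter, Finset.mem_univ, true_and, Set.mem_ofPred_eq] at hi hj
    exact rank_injOn G p (hi.trans hj.symm) hij
  have himg : ({i | p i = t} : Finset (Fin n)).image (rank G p) = range #{i | p i = t} := by
    apply Finset.eq_of_subset_of_card_le
    · intro r hr
      simp only [mem_image, mem_filter, mem_univ, true_and] at hr
      obtain ⟨i, rfl, rfl⟩ := hr
      exact mem_range.2 (rank_lt_card G p i)
    · rw [card_range, card_image_of_injOn hinj]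
  rw [← Finset.filter_filter,
    ← card_image_of_injOn (hinj.mono (by exact_mod_cast Finset.filter_subset _ _))]
  rw [← Finset.filter_image (p := fun r => r < q), himg, ← card_range (min q _)]
  congr 1
  ext r
  simp only [mem_filter, mem_range, lt_min_iff]
  exact and_comm

theorem card_topAgents (k : ℕ) (G : AgentGraph n) (p : Fin n → Fin m) (T : Finset (Fin m)) :
    #(topAgents k G p T) = ∑ t, min (quota k T t) #{i | p i = t} := by
  rw [Finset.card_eq_sum_card_fiberwise (f := p) (t := Finset.univ) (by intro x _; simp)]
  refine Finset.sum_congr rfl fun t _ => ?_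
  rw [← card_rank_lt G p t]
  congr 1
  ext i
  simp only [topAgents, mem_filter, mem_univ, true_and]
  constructor
  · rintro ⟨h, rfl⟩
    exact ⟨rfl, h⟩
  · rintro ⟨rfl, h⟩
    exact ⟨h, rfl⟩

theorem crossIndeg_congr {G G' : AgentGraph n} {i : Fin n} (h : DifferOnlyAt i G G')
    (p : Fin n → Fin m) {j : Fin n} (hj : p j = p i) : crossIndeg G p j = crossIndeg G' p j := by
  unfold crossIndeg
  congr 1
  ext l
  simp only [mem_filter, mem_univ, true_and]
  by_cases hl : l = i
  · subst hl
    simp [hj]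
  · rw [h l hl j]

theorem rank_congr {G G' : AgentGraph n} {i : Fin n} (h : DifferOnlyAt i G G')
    (p : Fin n → Fin m) : rank G p i = rank G' p i := by
  unfold rank
  congr 1
  ext j
  simp only [mem_filter, mem_univ, true_and]
  refine and_congr_right fun hj => ?_
  unfold Before
  rw [crossIndeg_congr h p hj, crossIndeg_congr h p rfl]

theorem isStrategyproof_randomPartition (n k m : ℕ) (hkn : k ≤ n) (hm : 0 < m) :
    IsStrategyproof (randomPartition n k m hkn hm) := by
  intro i G G' h
  have key : ∀ (p : Fin n → Fin m) (T : PartSubset k m),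
      utility (fill hkn (topAgents k G p T.1) (card_topAgents_le k G p hm T.2)) i
        = utility (fill hkn (topAgents k G' p T.1) (card_topAgents_le k G' p hm T.2)) i := by
    intro p T
    have hmem : i ∈ topAgents k G p T.1 ↔ i ∈ topAgents k G' p T.1 := by
      simp [topAgents, rank_congr h p]
    have hcard : #(topAgents k G p T.1) = #(topAgents k G' p T.1) := by
      rw [card_topAgents, card_topAgents]
    by_cases hi : i ∈ topAgents k G p T.1
    · rw [utility_fill_of_mem hkn _ hi, utility_fill_of_mem hkn _ (hmem.1 hi)]
    · rw [utility_fill_of_notMem hkn _ hi, utility_fill_of_notMem hkn _ (fun h' => hi (hmem.2 h')),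
        hcard]
  rw [utility_randomPartition, utility_randomPartition]
  simp only [key]

/-! ### Indegree captured by the top agents of each part. -/

theorem exists_threshold {s A : Finset (Fin n)} (c : Fin n → ℕ) (hA : A.Nonempty)
    (h : ∀ i ∈ A, ∀ j ∈ s, j ∉ A → c j ≤ c i) :
    ∃ θ : ℕ, (∀ i ∈ A, θ ≤ c i) ∧ ∀ j ∈ s, j ∉ A → c j ≤ θ := by
  obtain ⟨i, hi, hmin⟩ := exists_min_image A c hA
  exact ⟨c i, hmin, h i hi⟩

/-- If `A` consists of top elements of `s`, its weight is at least a fraction `w` of the weight of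
any `K ⊆ s` that is not too large compared to `A`. -/
theorem mul_sum_le_sum_top {s A K : Finset (Fin n)} (c : Fin n → ℕ) (hAs : A ⊆ s) (hKs : K ⊆ s)
    (htop : ∀ i ∈ A, ∀ j ∈ s, j ∉ A → c j ≤ c i) {q : ℕ} (hq : #A = min q #s)
    {w : ℝ} (hw0 : 0 ≤ w) (hw1 : w ≤ 1) (hwK : w * #K ≤ q) :
    w * ∑ i ∈ K, (c i : ℝ) ≤ ∑ i ∈ A, (c i : ℝ) := by
  have hK0 : 0 ≤ ∑ i ∈ K, (c i : ℝ) := Finset.sum_nonneg fun _ _ => Nat.cast_nonneg _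
  rcases le_total #s q with hsq | hsq
  · have hAs' : A = s := Finset.eq_of_subset_of_card_le hAs (by rw [hq, min_eq_right hsq])
    calc w * ∑ i ∈ K, (c i : ℝ) ≤ 1 * ∑ i ∈ K, (c i : ℝ) := by gcongr
      _ = ∑ i ∈ K, (c i : ℝ) := one_mul _
      _ ≤ _ := Finset.sum_le_sum_of_subset_of_nonneg (hAs' ▸ hKs) fun _ _ _ => Nat.cast_nonneg _
  rw [min_eq_left hsq] at hq
  rcases A.eq_empty_or_nonempty with rfl | hA
  -- With zero quota, `hwK` forces `K` to be empty or `w = 0`.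
  · have hq0 : q = 0 := by simpa using hq.symm
    rcases K.eq_empty_or_nonempty with rfl | hK
    · simp
    · have hKpos : (0 : ℝ) < #K := by exact_mod_cast hK.card_pos
      have : w = 0 := by
        subst hq0
        push_cast at hwK
        nlinarith
      simp [this]
  -- Measured relative to `θ`, elements of `A` have nonnegative excess and the rest of `s`
  -- nonpositive excess, so `A` has at least the excess of `K`; the remaining `w * #K * θ` is paid
  -- for by `q * θ`.
  obtain ⟨θ, hθA, hθs⟩ := exists_threshold c hA htop
  have hR : ∑ i ∈ A, (c i : ℝ) = ∑ i ∈ A, ((c i : ℝ) - θ) + q * θ := by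
    rw [Finset.sum_sub_distrib, Finset.sum_const, hq, nsmul_eq_mul]
    ring
  have hKθ : ∑ i ∈ K, (c i : ℝ) ≤ ∑ i ∈ A, ((c i : ℝ) - θ) + #K * θ := by
    have h1 : ∑ i ∈ K, ((c i : ℝ) - θ) ≤ ∑ i ∈ A, ((c i : ℝ) - θ) := by
      calc ∑ i ∈ K, ((c i : ℝ) - θ) ≤ ∑ i ∈ K with i ∈ A, ((c i : ℝ) - θ) := by
            rw [← Finset.sum_filter_add_sum_filter_not K (· ∈ A)]
            have : ∑ i ∈ K with i ∉ A, ((c i : ℝ) - θ) ≤ 0 := by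
              refine Finset.sum_nonpos fun i hi => ?_
              rw [mem_filter] at hi
              have : (c i : ℝ) ≤ θ := by exact_mod_cast hθs i (hKs hi.1) hi.2
              linarith
            linarith
        _ ≤ _ := by
            refine Finset.sum_le_sum_of_subset_of_nonneg (fun i hi => (mem_filter.1 hi).2) ?_
            intro i hi _
            have : (θ : ℝ) ≤ c i := by exact_mod_cast hθA i hi
            linarith
    rw [Finset.sum_sub_distrib, Finset.sum_const, nsmul_eq_mul] at h1
    linarith
  have hA0 : 0 ≤ ∑ i ∈ A, ((c i : ℝ) - θ) := by
    refine Finset.sum_nonneg fun i hi => ?_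
    have : (θ : ℝ) ≤ c i := by exact_mod_cast hθA i hi
    linarith
  have hθ0 : (0 : ℝ) ≤ θ := Nat.cast_nonneg _
  rw [hR]
  have h2 := mul_le_mul_of_nonneg_left hKθ hw0
  have h3 := mul_le_mul_of_nonneg_right hwK hθ0
  have h4 := mul_le_mul_of_nonneg_right hw1 hA0
  linarith

theorem sum_crossIndeg_mul_le (k : ℕ) (G : AgentGraph n) (p : Fin n → Fin m)
    (T : Finset (Fin m)) (K : Finset (Fin n)) (w : Fin m → ℝ) (hw0 : ∀ t, 0 ≤ w t)
    (hw1 : ∀ t, w t ≤ 1) (hwK : ∀ t, w t * #{i ∈ K | p i = t} ≤ quota k T t) :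
    ∑ i ∈ K, (crossIndeg G p i : ℝ) * w (p i) ≤ ∑ i ∈ topAgents k G p T, (indeg G i : ℝ) := by
  classical
  have hle : ∑ i ∈ topAgents k G p T, (crossIndeg G p i : ℝ)
      ≤ ∑ i ∈ topAgents k G p T, (indeg G i : ℝ) := by
    refine Finset.sum_le_sum fun i _ => ?_
    unfold crossIndeg indeg
    norm_cast
    refine Finset.card_le_card fun j hj => ?_
    simp only [mem_filter, mem_univ, true_and] at hj ⊢
    exact hj.1
  refine le_trans ?_ hle
  rw [← Finset.sum_fiberwise K p, ← Finset.sum_fiberwise (topAgents k G p T) p]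
  refine Finset.sum_le_sum fun t _ => ?_
  calc ∑ i ∈ K with p i = t, (crossIndeg G p i : ℝ) * w (p i)
      = w t * ∑ i ∈ K with p i = t, (crossIndeg G p i : ℝ) := by
        rw [Finset.mul_sum]
        refine Finset.sum_congr rfl fun i hi => ?_
        rw [(mem_filter.1 hi).2, mul_comm]
    _ ≤ _ := by
        have hfil : {i ∈ topAgents k G p T | p i = t}
            = ({i | p i = t ∧ rank G p i < quota k T t} : Finset (Fin n)) := by
          ext i
          simp only [topAgents, mem_filter, mem_univ, true_and]
          constructor
          · rintro ⟨h, rfl⟩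
            exact ⟨rfl, h⟩
          · rintro ⟨rfl, h⟩
            exact ⟨h, rfl⟩
        refine mul_sum_le_sum_top (s := {i | p i = t}) (q := quota k T t) (crossIndeg G p)
          ?_ ?_ ?_ ?_ (hw0 t) (hw1 t) (hwK t)
        · intro i hi
          simpa using (mem_filter.1 hi).2
        · intro i hi
          simpa using (mem_filter.1 hi).2
        · intro i hi j hj hjA
          rw [hfil] at hi hjA
          simp only [mem_filter, mem_univ, true_and, not_and, not_lt] at hi hj hjA
          have hr := hjA hj
          by_contra hlt
          have := rank_lt_of_before G p (hj.trans hi.1.symm) (Or.inl (not_le.1 hlt))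
          omega
        · rw [hfil, card_rank_lt]

theorem crossIndeg_eq_sum (G : AgentGraph n) (p : Fin n → Fin m) (i : Fin n)
    [DecidablePred fun j => G.Adj j i] :
    (crossIndeg G p i : ℝ) = ∑ j with G.Adj j i, if p j ≠ p i then (1 : ℝ) else 0 := by
  classical
  unfold crossIndeg
  rw [Finset.sum_boole, Finset.filter_filter]
  norm_cast

/-- A lower bound on the expected quality of the outcome from a lower bound on the weighted
probability that a single edge is counted. -/
theorem mul_sum_indeg_le_expect {k : ℕ} (hkn : k ≤ n) (hm : 0 < m) (G : AgentGraph n)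
    (K : Finset (Fin n)) (w : (Fin n → Fin m) → Finset (Fin m) → Fin m → ℝ)
    (hw0 : ∀ p T t, 0 ≤ w p T t) (hw1 : ∀ p T t, w p T t ≤ 1)
    (hwK : ∀ p (T : PartSubset k m) t, w p T.1 t * #{i ∈ K | p i = t} ≤ quota k T.1 t)
    {β : ℝ} (hβ : ∀ (T : PartSubset k m), ∀ v ∈ K, ∀ u, u ≠ v →
      β * Fintype.card (Fin n → Fin m)
        ≤ ∑ p : Fin n → Fin m, (if p u ≠ p v then (1 : ℝ) else 0) * w p T.1 (p v)) :
    β * ∑ i ∈ K, (indeg G i : ℝ)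
      ≤ expect (randomPartition n k m hkn hm G) (fun S => ∑ i ∈ S.1, (indeg G i : ℝ)) := by
  classical
  have : Nonempty (Fin m) := ⟨⟨0, hm⟩⟩
  have := partSubset_nonempty k hm
  have hN : (0 : ℝ) < Fintype.card (Fin n → Fin m) := by exact_mod_cast Fintype.card_pos
  have hP : (0 : ℝ) < Fintype.card (PartSubset k m) := by exact_mod_cast Fintype.card_pos
  -- The bound holds for every fixed `T`, so the distribution of `T` plays no role.
  have hT : ∀ T : PartSubset k m, (β * ∑ i ∈ K, (indeg G i : ℝ)) * Fintype.card (Fin n → Fin m)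
      ≤ ∑ p : Fin n → Fin m,
        expect (fill hkn (topAgents k G p T.1) (card_topAgents_le k G p hm T.2))
          (fun S => ∑ i ∈ S.1, (indeg G i : ℝ)) := by
    intro T
    calc (β * ∑ i ∈ K, (indeg G i : ℝ)) * Fintype.card (Fin n → Fin m)
        = ∑ v ∈ K, ∑ u with G.Adj u v, β * Fintype.card (Fin n → Fin m) := by
          rw [mul_right_comm, Finset.mul_sum]
          refine Finset.sum_congr rfl fun v _ => ?_
          rw [Finset.sum_const, nsmul_eq_mul, mul_comm]
          congr 2
      _ ≤ ∑ v ∈ K, ∑ u with G.Adj u v, ∑ p : Fin n → Fin m,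
            (if p u ≠ p v then (1 : ℝ) else 0) * w p T.1 (p v) := by
          refine Finset.sum_le_sum fun v hv => Finset.sum_le_sum fun u hu => hβ T v hv u ?_
          rintro rfl
          exact G.loopless u (mem_filter.1 hu).2
      _ = ∑ p : Fin n → Fin m, ∑ v ∈ K, (crossIndeg G p v : ℝ) * w p T.1 (p v) := by
          rw [Finset.sum_comm]
          refine Finset.sum_congr rfl fun v _ => ?_
          rw [Finset.sum_comm]
          refine Finset.sum_congr rfl fun p _ => ?_
          rw [crossIndeg_eq_sum, Finset.sum_mul]
      _ ≤ _ := Finset.sum_le_sum fun p _ =>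
          (sum_crossIndeg_mul_le k G p T.1 K (w p T.1) (hw0 p T.1) (hw1 p T.1) (hwK p T)).trans
            (sum_le_expect_fill hkn _ _ _ fun _ => Nat.cast_nonneg _)
  rw [expect_randomPartition, ← Finset.mul_sum, Finset.sum_comm, inv_mul_eq_div, le_div_iff₀ hN,
    inv_mul_eq_div, le_div_iff₀ hP]
  calc _ = ∑ _T : PartSubset k m,
        (β * ∑ i ∈ K, (indeg G i : ℝ)) * Fintype.card (Fin n → Fin m) := by
        rw [Finset.sum_const, card_univ, nsmul_eq_mul, mul_comm]
    _ ≤ _ := Finset.sum_le_sum fun T _ => hT T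

end Parts


/-! ### Independence and second moments for a uniformly random partition. -/

section RandomAssignment

variable {ι : Type*} [Fintype ι] [DecidableEq ι] {m : ℕ}

/-- Resampling one coordinate of a uniformly random assignment does not change expectations. -/
theorem sum_sum_update (g : (ι → Fin m) → ℝ) (w : ι) :
    ∑ p : ι → Fin m, ∑ s : Fin m, g (Function.update p w s) = m * ∑ p, g p := by
  -- Exchanging the fresh value with the old one is an involution on pairs, hence preserves the sum
  -- over pairs.
  have hinv : Function.Involutive
      (fun x : (ι → Fin m) × Fin m => (Function.update x.1 w x.2, x.1 w)) := by
    rintro ⟨p, s⟩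
    simp
  have h := Equiv.sum_comp hinv.toPerm (fun x : (ι → Fin m) × Fin m => g x.1)
  simp only [Function.Involutive.coe_toPerm] at h
  rw [Fintype.sum_prod_type, Fintype.sum_prod_type] at h
  rw [h, Finset.mul_sum]
  simp

/-- The part of `w` is independent of what does not depend on the part of `w`. -/
theorem mul_sum_ite_eq (w : ι) (τ : (ι → Fin m) → Fin m) (h : (ι → Fin m) → ℝ)
    (hτ : ∀ p s, τ (Function.update p w s) = τ p) (hh : ∀ p s, h (Function.update p w s) = h p) :
    m * ∑ p : ι → Fin m, (if p w = τ p then (1 : ℝ) else 0) * h p = ∑ p : ι → Fin m, h p := by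
  rw [← sum_sum_update _ w]
  refine Finset.sum_congr rfl fun p _ => ?_
  simp [hτ, hh]

theorem sum_ite_eq_div (hm : 0 < m) (w : ι) (τ : (ι → Fin m) → Fin m) (h : (ι → Fin m) → ℝ)
    (hτ : ∀ p s, τ (Function.update p w s) = τ p) (hh : ∀ p s, h (Function.update p w s) = h p) :
    ∑ p : ι → Fin m, (if p w = τ p then (1 : ℝ) else 0) * h p
      = (∑ p : ι → Fin m, h p) / m := by
  rw [eq_div_iff (by positivity), mul_comm, mul_sum_ite_eq w τ h hτ hh]

theorem sum_ite_ne_mul (hm : 0 < m) {u v : ι} (huv : u ≠ v) (h : Fin m → ℝ) :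
    ∑ p : ι → Fin m, (if p u ≠ p v then (1 : ℝ) else 0) * h (p v)
      = (1 - 1 / m) * ∑ p : ι → Fin m, h (p v) := by
  have h1 := sum_ite_eq_div hm u (fun p => p v) (fun p => h (p v))
    (fun p s => Function.update_of_ne huv.symm _ _)
    (fun p s => by rw [Function.update_of_ne huv.symm])
  have h2 : ∑ p : ι → Fin m, (if p u ≠ p v then (1 : ℝ) else 0) * h (p v)
      = ∑ p : ι → Fin m, h (p v)
        - ∑ p : ι → Fin m, (if p u = p v then (1 : ℝ) else 0) * h (p v) := by
    rw [← Finset.sum_sub_distrib]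
    refine Finset.sum_congr rfl fun p _ => ?_
    by_cases hp : p u = p v <;> simp [hp]
  rw [h2, h1]
  ring

theorem sum_apply_eq (hm : 0 < m) (v : ι) (h : Fin m → ℝ) :
    ∑ p : ι → Fin m, h (p v) = Fintype.card (ι → Fin m) * ((∑ t, h t) / m) := by
  have h1 := sum_sum_update (fun p : ι → Fin m => h (p v)) v
  simp only [Function.update_self, Finset.sum_const, card_univ, nsmul_eq_mul] at h1
  field_simp
  linarith

/-- The variance of the number of elements of `J` in the part of `v ∉ J`. -/
theorem sum_sq_sum_centered (hm : 0 < m) {v : ι} {J : Finset ι} (hv : v ∉ J) :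
    ∑ p : ι → Fin m, (∑ w ∈ J, ((if p w = p v then (1 : ℝ) else 0) - 1 / m)) ^ 2
      = Fintype.card (ι → Fin m) * (#J * (1 / m * (1 - 1 / m))) := by
  have hm' : (m : ℝ) ≠ 0 := by positivity
  have hone : ∀ w ∈ J, ∑ p : ι → Fin m, (if p w = p v then (1 : ℝ) else 0)
      = Fintype.card (ι → Fin m) / m := by
    intro w hw
    have hwv : v ≠ w := fun h => hv (h ▸ hw)
    have := sum_ite_eq_div hm w (fun p => p v) (fun _ => 1)
      (fun p s => Function.update_of_ne hwv _ _) (fun _ _ => rfl)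
    simpa using this
  have hdiag : ∀ w ∈ J, ∑ p : ι → Fin m, ((if p w = p v then (1 : ℝ) else 0) - 1 / m)
        * ((if p w = p v then (1 : ℝ) else 0) - 1 / m)
      = Fintype.card (ι → Fin m) * (1 / m * (1 - 1 / m)) := by
    intro w hw
    calc _ = ∑ p : ι → Fin m,
          ((if p w = p v then (1 : ℝ) else 0) * (1 - 2 / m) + 1 / m * (1 / m)) := by
          refine Finset.sum_congr rfl fun p _ => ?_
          split_ifs <;> ring
      _ = _ := by
          rw [Finset.sum_add_distrib, ← Finset.sum_mul, hone w hw, Finset.sum_const, card_univ,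
            nsmul_eq_mul]
          ring
  -- Covariances vanish: with all parts but that of `w` fixed, the indicator of `p w = p v` has mean
  -- `1 / m`.
  have hoff : ∀ w ∈ J, ∀ w' ∈ J, w' ≠ w →
      ∑ p : ι → Fin m, ((if p w = p v then (1 : ℝ) else 0) - 1 / m)
        * ((if p w' = p v then (1 : ℝ) else 0) - 1 / m) = 0 := by
    intro w hw w' hw' hne
    have hwv : v ≠ w := fun h => hv (h ▸ hw)
    have := sum_ite_eq_div hm w (fun p => p v)
      (fun p => (if p w' = p v then (1 : ℝ) else 0) - 1 / m)
      (fun p s => Function.update_of_ne hwv _ _)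
      (fun p s => by rw [Function.update_of_ne hwv, Function.update_of_ne hne])
    simp only [sub_mul (if _ then (1 : ℝ) else 0)]
    rw [Finset.sum_sub_distrib, this, ← Finset.mul_sum]
    ring
  simp only [sq, Finset.sum_mul_sum]
  rw [Finset.sum_comm]
  simp only [Finset.sum_comm (s := (univ : Finset (ι → Fin m)))]
  rw [Finset.sum_congr rfl (g := fun _ =>
    (Fintype.card (ι → Fin m) : ℝ) * (1 / m * (1 - 1 / m)))]
  · rw [Finset.sum_const, nsmul_eq_mul]
    ring
  · intro w hw
    rw [Finset.sum_eq_single w (fun w' hw' hne => hoff w hw w' hw' hne) (fun h => absurd hw h),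
      hdiag w hw]

/-- The variance is at most `#J / m ≤ s ^ 2`; the pointwise bound `|y| ≤ y ^ 2 / (2 * s) + s / 2`
replaces Cauchy–Schwarz. -/
theorem sum_abs_sum_centered_le (hm : 0 < m) {v : ι} {J : Finset ι} (hv : v ∉ J) {s : ℝ}
    (hs : 0 < s) (hJ : (#J : ℝ) / m ≤ s ^ 2) :
    ∑ p : ι → Fin m, |∑ w ∈ J, ((if p w = p v then (1 : ℝ) else 0) - 1 / m)|
      ≤ Fintype.card (ι → Fin m) * s := by
  have hm1 : (1 : ℝ) ≤ m := by exact_mod_cast hm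
  have habs : ∀ y : ℝ, |y| ≤ y ^ 2 * (1 / (2 * s)) + s / 2 := by
    intro y
    have h1 : 2 * s * |y| ≤ y ^ 2 + s ^ 2 := by
      rw [← sq_abs y]
      nlinarith [sq_nonneg (|y| - s)]
    have h2 : y ^ 2 * (1 / (2 * s)) + s / 2 = (y ^ 2 + s ^ 2) / (2 * s) := by
      field_simp
    rw [h2, le_div_iff₀ (by positivity)]
    linarith
  calc _ ≤ ∑ p : ι → Fin m,
        ((∑ w ∈ J, ((if p w = p v then (1 : ℝ) else 0) - 1 / m)) ^ 2 * (1 / (2 * s)) + s / 2) :=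
        Finset.sum_le_sum fun p _ => habs _
    _ = Fintype.card (ι → Fin m) * (#J * (1 / m * (1 - 1 / m)) * (1 / (2 * s)) + s / 2) := by
        rw [Finset.sum_add_distrib, ← Finset.sum_mul, sum_sq_sum_centered hm hv,
          Finset.sum_const, card_univ, nsmul_eq_mul]
        ring
    _ ≤ _ := by
        gcongr
        have h3 : (#J : ℝ) * (1 / m * (1 - 1 / m)) ≤ s ^ 2 := by
          refine le_trans ?_ hJ
          have : (#J : ℝ) * (1 / m * (1 - 1 / m)) = #J / m * (1 - 1 / m) := by ring
          rw [this]
          refine mul_le_of_le_one_right (by positivity) ?_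
          have : (0 : ℝ) ≤ 1 / m := by positivity
          linarith
        have h4 : (#J : ℝ) * (1 / m * (1 - 1 / m)) * (1 / (2 * s)) ≤ s ^ 2 * (1 / (2 * s)) := by
          gcongr
        have h5 : s ^ 2 * (1 / (2 * s)) = s / 2 := by field_simp
        linarith

end RandomAssignment


/-! ### The two approximation ratios. -/

section Ratio

variable {n k m : ℕ}

theorem quota_le (hk : 1 ≤ k) (hm : 0 < m) (T : Finset (Fin m)) (t : Fin m) :
    quota k T t ≤ k := by
  unfold quota
  split_ifs
  · rw [Nat.ceilDiv_eq_add_pred_div]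
    refine Nat.div_le_of_le_mul ?_
    nlinarith [Nat.sub_le (k + m) 1, Nat.sub_add_cancel (show 1 ≤ k + m by omega)]
  · exact Nat.div_le_self k m

theorem div_le_quota (hm : 0 < m) (T : Finset (Fin m)) (t : Fin m) : k / m ≤ quota k T t := by
  unfold quota
  split_ifs
  · rw [Nat.ceilDiv_eq_add_pred_div]
    exact Nat.div_le_div_right (by omega)
  · exact le_rfl

theorem sum_quota (hm : 0 < m) (T : PartSubset k m) : ∑ t, quota k T.1 t = k := by
  refine le_antisymm (sum_quota_le k hm T.2) ?_
  have hle := Nat.mul_div_le k m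
  have hq : ∀ t, (k / m + if t ∈ T.1 then 1 else 0) ≤ quota k T.1 t := by
    intro t
    split_ifs with ht
    -- If `T` is nonempty then `m` does not divide `k`, so the ceiling really exceeds the floor by
    -- one.
    · have hpos : 0 < k - m * (k / m) := by
        rw [← T.2]
        exact card_pos.2 ⟨t, ht⟩
      unfold quota
      rw [if_pos ht, Nat.ceilDiv_eq_add_pred_div, Nat.le_div_iff_mul_le hm]
      have : (k / m + 1) * m = m * (k / m) + m := by ring
      omega
    · exact div_le_quota hm T.1 t
  calc k = m * (k / m) + #T.1 := by
        rw [T.2]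
        omega
    _ = ∑ t, (k / m + if t ∈ T.1 then 1 else 0) := by
        rw [Finset.sum_add_distrib]
        simp
    _ ≤ _ := Finset.sum_le_sum fun t _ => hq t

theorem exists_opt_eq_sum (hkn : k ≤ n) (G : AgentGraph n) :
    ∃ K : Finset (Fin n), #K = k ∧ opt k G = ∑ i ∈ K, indeg G i := by
  have h : (powersetCard k (univ : Finset (Fin n))).Nonempty :=
    powersetCard_nonempty_of_le (by simpa using hkn)
  obtain ⟨K, hK, hopt⟩ := exists_mem_eq_sup _ h (fun S => ∑ i ∈ S, indeg G i)
  exact ⟨K, (mem_powersetCard.1 hK).2, hopt⟩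

/-- The weight `quota / k` is admissible because `#K = k`. Its mean over the uniform part of `v` is
`1 / m`, since the quotas add up to `k`, and the edge crosses independently with probability `1 -
1/m`. -/
theorem opt_mul_le_expect (hk : 1 ≤ k) (hkn : k ≤ n) (hm : 0 < m) (G : AgentGraph n) :
    (1 - 1 / m) / m * (opt k G : ℝ)
      ≤ expect (randomPartition n k m hkn hm G) (fun S => ∑ i ∈ S.1, (indeg G i : ℝ)) := by
  obtain ⟨K, hK, hopt⟩ := exists_opt_eq_sum hkn G
  have hk0 : (0 : ℝ) < k := by exact_mod_cast hk
  rw [hopt]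
  push_cast
  refine mul_sum_indeg_le_expect hkn hm G K (fun _ T t => quota k T t / k)
    (fun _ _ _ => by positivity) (fun _ T t => ?_) (fun p T t => ?_) (fun T v _ u huv => ?_)
  · rw [div_le_one hk0]
    exact_mod_cast quota_le hk hm T t
  · rw [div_mul_eq_mul_div, div_le_iff₀ hk0]
    gcongr
    exact (card_le_card (filter_subset _ _)).trans_eq hK
  · rw [sum_ite_ne_mul hm huv (fun t => (quota k T.1 t : ℝ) / k),
      sum_apply_eq hm v (fun t => (quota k T.1 t : ℝ) / k), ← Finset.sum_div, ← Nat.cast_sum,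
      sum_quota hm T, div_self hk0.ne']
    apply le_of_eq
    ring

/-- The weight falls short of `1` only by the relative overflow of the part of `v`. The `2` in the
loss is one for `v` itself and one for rounding `k / m` down; `s` bounds the mean absolute
fluctuation `|Z|` of the other members of `K`. -/
theorem one_sub_mul_opt_le_expect (hkn : k ≤ n) (hm : 0 < m) (hmk : m ≤ k) {s : ℝ} (hs : 0 < s)
    (hks : (k : ℝ) / m ≤ s ^ 2) (G : AgentGraph n) :
    (1 - 1 / m - (2 + s) / (k / m : ℕ)) * (opt k G : ℝ)
      ≤ expect (randomPartition n k m hkn hm G) (fun S => ∑ i ∈ S.1, (indeg G i : ℝ)) := by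
  obtain ⟨K, hK, hopt⟩ := exists_opt_eq_sum hkn G
  have hf : (0 : ℝ) < (k / m : ℕ) := by exact_mod_cast Nat.div_pos hmk hm
  have hm0 : (0 : ℝ) < m := by exact_mod_cast hm
  have hfq : ∀ T : Finset (Fin m), ∀ t, ((k / m : ℕ) : ℝ) ≤ quota k T t := fun T t => by
    exact_mod_cast div_le_quota hm T t
  have hfk : (k : ℝ) / m ≤ (k / m : ℕ) + 1 := by
    rw [← Nat.floor_div_eq_div (K := ℝ)]
    exact (Nat.lt_floor_add_one _).le
  rw [hopt]
  push_cast
  refine mul_sum_indeg_le_expect hkn hm G K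
    (fun p T t => quota k T t / max (quota k T t : ℝ) #{i ∈ K | p i = t})
    (fun _ _ _ => by positivity) (fun _ T t => ?_) (fun p T t => ?_) (fun T v hv u huv => ?_)
  · have := hf.trans_le (hfq T t)
    rw [div_le_one (lt_max_of_lt_left this)]
    exact le_max_left _ _
  · have := hf.trans_le (hfq T t)
    rw [div_mul_eq_mul_div, div_le_iff₀ (lt_max_of_lt_left this)]
    gcongr
    exact le_max_right _ _
  set Z : (Fin n → Fin m) → ℝ := fun p =>
    ∑ w ∈ K.erase v, ((if p w = p v then (1 : ℝ) else 0) - 1 / m) with hZ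
  have hpt : ∀ p : Fin n → Fin m,
      (if p u ≠ p v then (1 : ℝ) else 0) * 1 - (2 + |Z p|) / (k / m : ℕ)
        ≤ (if p u ≠ p v then (1 : ℝ) else 0)
          * (quota k T.1 (p v) / max (quota k T.1 (p v) : ℝ) #{i ∈ K | p i = p v}) := by
    intro p
    have hX : (#{i ∈ K | p i = p v} : ℝ) ≤ 1 + k / m + Z p := by
      have h1 : (#{i ∈ K | p i = p v} : ℝ)
          = 1 + ∑ w ∈ K.erase v, (if p w = p v then (1 : ℝ) else 0) := by
        rw [← Finset.sum_boole, ← Finset.add_sum_erase K _ hv, if_pos rfl]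
      have h2 : Z p = ∑ w ∈ K.erase v, (if p w = p v then (1 : ℝ) else 0)
          - #(K.erase v) * (1 / m) := by
        rw [hZ]
        simp only [Finset.sum_sub_distrib, Finset.sum_const, nsmul_eq_mul]
      have h3 : (#(K.erase v) : ℝ) * (1 / m) ≤ k / m := by
        rw [mul_one_div]
        rw [← hK]
        gcongr
        exact erase_subset _ _
      linarith
    have hq := hfq T.1 (p v)
    generalize (quota k T.1 (p v) : ℝ) = q at *
    generalize (#{i ∈ K | p i = p v} : ℝ) = X at *
    have hq0 := hf.trans_le hq
    have hM0 : 0 < max q X := lt_max_of_lt_left hq0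
    have hMq : max q X - q ≤ 2 + |Z p| := by
      rcases max_choice q X with h | h <;> rw [h]
      · rw [sub_self]
        positivity
      · linarith [le_abs_self (Z p)]
    have hMq0 : 0 ≤ max q X - q := sub_nonneg.2 (le_max_left _ _)
    have h1 : 1 - (2 + |Z p|) / (k / m : ℕ) ≤ q / max q X := by
      calc 1 - (2 + |Z p|) / (k / m : ℕ) ≤ 1 - (max q X - q) / q := by
            gcongr
        _ ≤ q / max q X := by
            rw [one_sub_div hq0.ne', div_le_div_iff₀ hq0 hM0]
            -- With `M = max q X`, this is `(2 * q - M) * M ≤ q ^ 2`.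
            nlinarith [sq_nonneg (max q X - q)]
    split_ifs
    · simpa using h1
    · simp only [zero_mul, zero_sub, neg_nonpos]
      positivity
  refine le_trans ?_ (Finset.sum_le_sum fun p _ => hpt p)
  have hE := sum_abs_sum_centered_le hm (v := v) (J := K.erase v) (by simp) hs (le_trans (by
    rw [← hK]
    gcongr
    exact erase_subset _ _) hks)
  rw [Finset.sum_sub_distrib, sum_ite_ne_mul hm huv (fun _ => 1), ← Finset.sum_div,
    Finset.sum_add_distrib, Finset.sum_const, Finset.sum_const, card_univ, nsmul_eq_mul,
    nsmul_eq_mul]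
  have h4 : ((Fintype.card (Fin n → Fin m) : ℝ) * 2 + ∑ p, |Z p|) / (k / m : ℕ)
      ≤ (2 + s) / (k / m : ℕ) * Fintype.card (Fin n → Fin m) := by
    rw [div_mul_eq_mul_div]
    gcongr
    linarith
  linarith

theorem hasApproxRatio_of_mul_le {f : Mechanism n k} {α β : ℝ} (hα : 0 ≤ α) (hαβ : 1 ≤ α * β)
    (h : ∀ G, β * (opt k G : ℝ) ≤ expect (f G) (fun S => ∑ i ∈ S.1, (indeg G i : ℝ))) :
    HasApproxRatio f α := by
  intro G
  have h1 := mul_le_mul_of_nonneg_left (h G) hα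
  have h2 := mul_le_mul_of_nonneg_right hαβ (Nat.cast_nonneg (α := ℝ) (opt k G))
  linarith

theorem hasApproxRatio_randomPartition_two (hk : 1 ≤ k) (hkn : k ≤ n) :
    HasApproxRatio (randomPartition n k 2 hkn two_pos) 4 :=
  hasApproxRatio_of_mul_le (β := (1 - 1 / (2 : ℕ)) / (2 : ℕ)) (by norm_num) (by norm_num)
    (opt_mul_le_expect hk hkn two_pos)

theorem hasApproxRatio_randomPartition_ceilCbrt (hk : 2 ≤ k) (hkn : k ≤ n) :
    HasApproxRatio (randomPartition n k (ceilCbrt k) hkn (ceilCbrt_pos (two_pos.trans_le hk)))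
      (1 + 2800 / (k : ℝ) ^ (1 / 3 : ℝ)) := by
  have hm := ceilCbrt_pos (two_pos.trans_le hk)
  have hk0 : (0 : ℝ) ≤ k := Nat.cast_nonneg k
  have hk1 : (1 : ℝ) < k := by exact_mod_cast hk
  have hr1 : 1 < (k : ℝ) ^ (1 / 3 : ℝ) := Real.one_lt_rpow hk1 (by norm_num)
  have hr3 : ((k : ℝ) ^ (1 / 3 : ℝ)) ^ 3 = k := by
    rw [← Real.rpow_natCast, ← Real.rpow_mul hk0]
    norm_num
  have hrm : (k : ℝ) ^ (1 / 3 : ℝ) ≤ ceilCbrt k := Nat.le_ceil _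
  have hmr : (ceilCbrt k : ℝ) < (k : ℝ) ^ (1 / 3 : ℝ) + 1 := Nat.ceil_lt_add_one (by positivity)
  have hmk : ceilCbrt k ≤ k := by
    refine Nat.ceil_le.2 ?_
    calc (k : ℝ) ^ (1 / 3 : ℝ) ≤ (k : ℝ) ^ (1 : ℝ) :=
          Real.rpow_le_rpow_of_exponent_le hk1.le (by norm_num)
      _ = k := Real.rpow_one _
  have hm2 : 2 ≤ ceilCbrt k := by
    have : (1 : ℝ) < ceilCbrt k := hr1.trans_le hrm
    exact_mod_cast this
  generalize (k : ℝ) ^ (1 / 3 : ℝ) = r at *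
  set m := ceilCbrt k
  have hm2' : (2 : ℝ) ≤ m := by exact_mod_cast hm2
  have hr0 : 0 < r := zero_lt_one.trans hr1
  have hm0 : (0 : ℝ) < m := by linarith
  -- For `r ≤ 26` the crude bound suffices: `2 ≤ m ≤ 27` gives at least `1/54`. Otherwise the loss
  -- is at most `13 / r = 1 / r + 12 / r`, below `1/2` as `26 = 2 * 13`; the constant `2800` is
  -- generous in both cases.
  rcases le_or_gt r 26 with hr | hr
  · refine hasApproxRatio_of_mul_le (by positivity) ?_
      (opt_mul_le_expect (by omega) hkn hm)
    have h1 : (1 : ℝ) / 54 ≤ (1 - 1 / m) / m := by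
      have : (1 : ℝ) / m ≤ 1 / 2 := by gcongr
      rw [div_le_div_iff₀ (by norm_num) hm0]
      linarith
    have h2 : (2800 : ℝ) / 26 ≤ 2800 / r := by gcongr
    nlinarith
  · refine hasApproxRatio_of_mul_le (β := 1 - 13 / r) (by positivity) ?_ fun G =>
      le_trans ?_ (one_sub_mul_opt_le_expect hkn hm hmk hr0 ?_ G)
    · have : (1 + 2800 / r) * (1 - 13 / r) = 1 + (2787 * r - 36400) / r ^ 2 := by
        field_simp
        ring
      rw [this, le_add_iff_nonneg_right]
      exact div_nonneg (by linarith) (by positivity)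
    · refine mul_le_mul_of_nonneg_right ?_ (Nat.cast_nonneg _)
      have hfk : (k : ℝ) / m < (k / m : ℕ) + 1 := by
        rw [← Nat.floor_div_eq_div (K := ℝ)]
        exact Nat.lt_floor_add_one _
      -- Here `k = r ^ 3` and `m < r + 1 ≤ 2 * r`.
      have hkm : r ^ 2 / 2 ≤ (k : ℝ) / m := by
        rw [div_le_div_iff₀ two_pos hm0, ← hr3]
        nlinarith [sq_nonneg r]
      have hf : r ^ 2 / 4 ≤ (k / m : ℕ) := by nlinarith
      have h1 : (1 : ℝ) / m ≤ 1 / r := by gcongr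
      have h2 : (2 + r) / (k / m : ℕ) ≤ 12 / r := by
        calc (2 + r) / (k / m : ℕ) ≤ (3 * r) / (r ^ 2 / 4) := by
              gcongr
              linarith
          _ = 12 / r := by
              field_simp
              norm_num
      have h3 : 13 / r = 1 / r + 12 / r := by ring
      linarith
    · rw [div_le_iff₀ hm0, ← hr3]
      nlinarith [sq_nonneg r]

end Ratio

end Selection

theorem theorem2 :
    (∀ (n k m : ℕ) (_ : 1 ≤ k) (hkn : k < n) (hm : 0 < m),
      Selection.IsStrategyproof (Selection.randomPartition n k m hkn.le hm)) ∧
    (∀ (n k : ℕ) (_ : 1 ≤ k) (hkn : k < n),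
      Selection.HasApproxRatio (Selection.randomPartition n k 2 hkn.le two_pos) 4) ∧
    (∃ C : ℝ, ∀ (n k : ℕ) (hk : 2 ≤ k) (hkn : k < n),
      Selection.HasApproxRatio
        (Selection.randomPartition n k (Selection.ceilCbrt k) hkn.le
          (Selection.ceilCbrt_pos (two_pos.trans_le hk)))
        (1 + C / (k : ℝ) ^ (1 / 3 : ℝ))) :=
  ⟨fun n k m _ hkn hm => Selection.isStrategyproof_randomPartition n k m hkn.le hm,
    fun _ _ hk hkn => Selection.hasApproxRatio_randomPartition_two hk hkn.le,
    2800, fun _ _ hk hkn => Selection.hasApproxRatio_randomPartition_ceilCbrt hk hkn.le⟩
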